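/- Let $W$ be a real vector space of dimension $8$. For an inner product $\langle\cdot,\cdot\rangle$ on $W$, a *triple cross product* is an alternating trilinear map $W^3\to W$, $(u,v,w)\mapsto u\times v\times w$, such that for all $u,v,w\in W$ the vector $u\times v\times w$ is orthogonal to $u$, $v$ and $w$, and $|u\times v\times w|^2=|u\wedge v\wedge w|^2$, where $|u\wedge v\wedge w|^2$ denotes the Gram determinant of $u,v,w$. A *Cayley-form* on $W$ is an alternating form $\Phi\in\Lambda^4W^*$ for which there is an inner product on $W$ such that the map $(u,v,w)\mapsto u\times v\times w$ determined by $$\langle x,u\times v\times w\rangle=\Phi(x,u,v,w)\qquad\text{for all }x\in W$$ is a triple cross product. A Cayley-form $\Phi$ is *positive* if, whenever $u,v\in W$ are linearly independent, the $8$-forms $$\Phi\wedge\Phi\qquad\text{and}\qquad \iota(v)\iota(u)\Phi\wedge\iota(v)\iota(u)\Phi\wedge\Phi$$ are both nonzero and induce the same orientation of $W$ (that is, they differ by a positive factor). Here $\iota(v)\iota(u)\Phi\in\Lambda^2W^*$ is the form $(x,y)\mapsto\Phi(u,v,x,y)$. **Theorem.** If $\Phi,\Psi\in\Lambda^4W^*$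 are two positive Cayley-forms, then there is an automorphism $g\in\mathrm{Aut}(W)$ (an invertible linear map $W\to W$) such that $g^*\Phi=\Psi$, where $(g^*\Phi)(x_1,x_2,x_3,x_4)=\Phi(gx_1,gx_2,gx_3,gx_4)$. -/

import Mathlib

namespace CayleyForm

variable {W : Type*} [AddCommGroup W] [Module ℝ W]

/-- The wedge product of two real-valued alternating forms, normalized as a sum over shuffles:
`(a ∧ b)(v₁, …, vₘ₊ₙ) = ∑ sign(σ) a(v_{σ 1}, …, v_{σ m}) b(v_{σ (m+1)}, …, v_{σ (m+n)})`. -/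
noncomputable def wedge {m n : ℕ} (a : W [⋀^Fin m]→ₗ[ℝ] ℝ) (b : W [⋀^Fin n]→ₗ[ℝ] ℝ) :
    W [⋀^Fin (m + n)]→ₗ[ℝ] ℝ :=
  ((LinearMap.mul' ℝ ℝ).compAlternatingMap (a.domCoprod b)).domDomCongr finSumFinEquiv

/-- The interior product `ι(v)ι(u)Φ`, that is, the 2-form `(x, y) ↦ Φ(u, v, x, y)`. -/
def interior₂ (Φ : W [⋀^Fin 4]→ₗ[ℝ] ℝ) (u v : W) : W [⋀^Fin 2]→ₗ[ℝ] ℝ :=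
  (Φ.curryLeft u).curryLeft v

/-- A triple cross product with respect to an inner product `c` on `W`: an alternating map
`τ(u, v, w) = u × v × w` orthogonal to each of its arguments, with
`|u × v × w|² = |u ∧ v ∧ w|²`, the latter being the Gram determinant of `u, v, w`. -/
structure IsTripleCrossProduct (c : InnerProductSpace.Core ℝ W) (τ : W [⋀^Fin 3]→ₗ[ℝ] W) :
    Prop where
  inner_left : ∀ u v w : W, c.inner (τ ![u, v, w]) u = 0
  inner_middle : ∀ u v w : W, c.inner (τ ![u, v, w]) v = 0
  inner_right : ∀ u v w : W, c.inner (τ ![u, v, w]) w = 0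
  norm_sq : ∀ u v w : W, c.inner (τ ![u, v, w]) (τ ![u, v, w]) =
    Matrix.det !![c.inner u u, c.inner u v, c.inner u w;
                  c.inner v u, c.inner v v, c.inner v w;
                  c.inner w u, c.inner w v, c.inner w w]

/-- The inner product `c` is compatible with the 4-form `Φ` if the map `(u, v, w) ↦ u × v × w`
determined by `⟨x, u × v × w⟩ = Φ(x, u, v, w)` is a triple cross product. -/
def IsCompatible (c : InnerProductSpace.Core ℝ W) (Φ : W [⋀^Fin 4]→ₗ[ℝ] ℝ) : Prop :=
  ∃ τ : W [⋀^Fin 3]→ₗ[ℝ] W, IsTripleCrossProduct c τ ∧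
    ∀ x u v w : W, c.inner x (τ ![u, v, w]) = Φ ![x, u, v, w]

/-- A 4-form is a Cayley-form if it admits a compatible inner product. -/
def IsCayleyForm (Φ : W [⋀^Fin 4]→ₗ[ℝ] ℝ) : Prop :=
  ∃ c : InnerProductSpace.Core ℝ W, IsCompatible c Φ

/-- Two top-degree forms on an 8-dimensional space induce the same orientation: both are nonzero
and they represent the same element of `Orientation ℝ W (Fin 8)`, i.e. they differ by a positive
factor. -/
def InduceSameOrientation (α β : W [⋀^Fin 8]→ₗ[ℝ] ℝ) : Prop :=
  ∃ (hα : α ≠ 0) (hβ : β ≠ 0),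
    (rayOfNeZero ℝ α hα : Orientation ℝ W (Fin 8)) = rayOfNeZero ℝ β hβ

/-- A Cayley-form `Φ` is positive if `Φ ∧ Φ` and `ι(v)ι(u)Φ ∧ ι(v)ι(u)Φ ∧ Φ` induce the same
orientation whenever `u, v` are linearly independent. -/
structure IsPositiveCayleyForm (Φ : W [⋀^Fin 4]→ₗ[ℝ] ℝ) : Prop where
  isCayleyForm : IsCayleyForm Φ
  sameOrientation : ∀ u v : W, LinearIndependent ℝ ![u, v] →
    InduceSameOrientation (wedge Φ Φ)
      (wedge (wedge (interior₂ Φ u v) (interior₂ Φ u v)) Φ)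

end CayleyForm

/-!
Let `τ` be the triple cross product of a Cayley-form `Φ` on `W`, so that `⟨x, τ(u, v, w)⟩ =
Φ(x, u, v, w)`. Choose orthonormal vectors `e₀, e₁, e₂`, put `e₃ = τ(e₀, e₁, e₂)`, choose a unit
vector `e₄` orthogonal to `e₀, …, e₃`, and put `e₅ = τ(e₀, e₁, e₄)`, `e₆ = τ(e₀, e₂, e₄)`,
`e₇ = τ(e₀, e₃, e₄)`. These eight vectors are orthonormal, and they determine `Φ` up to one sign:
the norm identity polarizes to
`⟨τ(u, v, w), τ(u, v', w')⟩ = -⟨τ(u, v', w), τ(u, v, w')⟩` for orthogonal vectors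
(`inner_cross_cross_swap`), and this yields first every value `Φ(e₀, eᵢ, eⱼ, eₖ)` and then every
value on `e₁, …, e₇` as a multiple by `0` or `±1` of the single number `ε = Φ(e₄, e₅, e₆, e₇)`,
while the norm of `τ(e₄, e₅, e₆)` gives `ε = ±1`. This normal form is
`IsCayleyForm.exists_isCayleyBasis`.

Replacing `e₀` by `-e₀` turns the normal form of `Φ` with sign `ε` into that of `-Φ` with sign `-ε`
(`IsCayleyBasis.neg`). Hence for two Cayley-forms `Φ`, `Ψ` there is an automorphism `g` with
`g^*Φ = Ψ` or `g^*Φ = -Ψ`. If both forms are positive the second case cannot occur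
(`IsPositiveCayleyForm.compLinearMap_ne_neg`): positivity is invariant under pullback, and passing
from `Ψ` to `-Ψ` fixes `Ψ ∧ Ψ` but reverses `ι(v)ι(u)Ψ ∧ ι(v)ι(u)Ψ ∧ Ψ`, so that `Ψ` and `-Ψ`
are not both positive.
-/

namespace CayleyForm

open scoped RealInnerProductSpace

/-! ### Pullback of wedge products, and positivity -/

section Pullback

variable {W W' : Type*} [AddCommGroup W] [Module ℝ W] [AddCommGroup W'] [Module ℝ W']

theorem wedge_compLinearMap {m n : ℕ} (a : W [⋀^Fin m]→ₗ[ℝ] ℝ) (b : W [⋀^Fin n]→ₗ[ℝ] ℝ)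
    (f : W' →ₗ[ℝ] W) :
    wedge (a.compLinearMap f) (b.compLinearMap f) = (wedge a b).compLinearMap f := by
  ext v
  simp only [wedge, AlternatingMap.domDomCongr_apply, LinearMap.compAlternatingMap_apply,
    AlternatingMap.compLinearMap_apply, AlternatingMap.domCoprod_apply,
    sum_apply]
  congr 1
  refine Finset.sum_congr rfl fun σ _ => ?_
  induction σ using Quotient.inductionOn'
  simp [AlternatingMap.domCoprod.summand_mk'']

theorem wedge_neg_left {m n : ℕ} (a : W [⋀^Fin m]→ₗ[ℝ] ℝ) (b : W [⋀^Fin n]→ₗ[ℝ] ℝ) :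
    wedge (-a) b = -wedge a b := by
  ext v
  simp only [wedge, AlternatingMap.domDomCongr_apply, LinearMap.compAlternatingMap_apply,
    AlternatingMap.neg_apply, AlternatingMap.domCoprod_apply, sum_apply]
  rw [← map_neg, ← Finset.sum_neg_distrib]
  congr 1
  refine Finset.sum_congr rfl fun σ _ => ?_
  induction σ using Quotient.inductionOn'
  simp [AlternatingMap.domCoprod.summand_mk'', TensorProduct.neg_tmul]

theorem wedge_neg_right {m n : ℕ} (a : W [⋀^Fin m]→ₗ[ℝ] ℝ) (b : W [⋀^Fin n]→ₗ[ℝ] ℝ) :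
    wedge a (-b) = -wedge a b := by
  ext v
  simp only [wedge, AlternatingMap.domDomCongr_apply, LinearMap.compAlternatingMap_apply,
    AlternatingMap.neg_apply, AlternatingMap.domCoprod_apply, sum_apply]
  rw [← map_neg, ← Finset.sum_neg_distrib]
  congr 1
  refine Finset.sum_congr rfl fun σ _ => ?_
  induction σ using Quotient.inductionOn'
  simp [AlternatingMap.domCoprod.summand_mk'', TensorProduct.tmul_neg]

theorem interior₂_compLinearMap (Φ : W [⋀^Fin 4]→ₗ[ℝ] ℝ) (f : W' →ₗ[ℝ] W) (u v : W') :
    interior₂ (Φ.compLinearMap f) u v = (interior₂ Φ (f u) (f v)).compLinearMap f := by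
  ext x
  simp only [interior₂, AlternatingMap.curryLeft_apply_apply, AlternatingMap.compLinearMap_apply]
  congr 1
  ext i
  refine Fin.cases rfl (fun i => Fin.cases rfl (fun i => rfl) i) i

theorem interior₂_neg (Φ : W [⋀^Fin 4]→ₗ[ℝ] ℝ) (u v : W) :
    interior₂ (-Φ) u v = -interior₂ Φ u v := by
  ext x
  simp [interior₂]

/-- Otherwise `-Ψ` would satisfy the orientation condition together with `Ψ`, although the two
differ in the sign of the second 8-form and not in that of the first. -/
theorem IsPositiveCayleyForm.compLinearMap_ne_neg
    (hW : 1 < Module.finrank ℝ W) {Φ Ψ : W [⋀^Fin 4]→ₗ[ℝ] ℝ}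
    (hΦ : IsPositiveCayleyForm Φ) (hΨ : IsPositiveCayleyForm Ψ) (g : W ≃ₗ[ℝ] W) :
    Φ.compLinearMap (g : W →ₗ[ℝ] W) ≠ -Ψ := by
  have : Nontrivial W := Module.nontrivial_of_finrank_pos (R := ℝ) (by omega)
  intro h
  obtain ⟨a, ha⟩ := exists_ne (0 : W)
  obtain ⟨b, hb⟩ := exists_linearIndependent_pair_of_one_lt_finrank
    (R := ℝ) hW ha
  have hgab : LinearIndependent ℝ ![g a, g b] := by
    have := hb.map' (g : W →ₗ[ℝ] W) (LinearEquiv.ker g)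
    rwa [show (g : W →ₗ[ℝ] W) ∘ ![a, b] = ![g a, g b] by ext i; fin_cases i <;> rfl] at this
  obtain ⟨h1, h2, h3⟩ := hΦ.sameOrientation _ _ hgab
  obtain ⟨k1, k2, k3⟩ := hΨ.sameOrientation _ _ hb
  rw [ray_eq_iff] at h3 k3
  have e : SameRay ℝ
      ((wedge Φ Φ).compLinearMap (g : W →ₗ[ℝ] W))
      ((wedge (wedge (interior₂ Φ (g a) (g b)) (interior₂ Φ (g a) (g b))) Φ).compLinearMap
        (g : W →ₗ[ℝ] W)) :=
    h3.map (AlternatingMap.domLCongr ℝ ℝ (Fin 8) ℝ g.symm).toLinearMap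
  have hi := interior₂_compLinearMap Φ (g : W →ₗ[ℝ] W) a b
  simp only [LinearEquiv.coe_coe] at hi
  simp only [← wedge_compLinearMap, ← hi, h, interior₂_neg, wedge_neg_left, wedge_neg_right,
    neg_neg] at e
  -- `h3` pulled back along `g` and `k3` make a nonzero form a nonnegative multiple of its negative.
  have := k3.symm.trans e (fun h => absurd h k1)
  exact k2 (eq_zero_of_sameRay_self_neg this)

end Pullback

/-! ### Orthonormal extension and alternating forms on a basis -/

section Basis

theorem exists_norm_eq_one_orthogonal {V ι : Type*} [NormedAddCommGroup V]
    [InnerProductSpace ℝ V] [Fintype ι] (v : ι → V)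
    (h : Fintype.card ι < Module.finrank ℝ V) :
    ∃ x : V, ⟪x, x⟫ = 1 ∧ ∀ i, ⟪v i, x⟫ = 0 := by
  have : FiniteDimensional ℝ V := FiniteDimensional.of_finrank_pos (by omega)
  have hne : (Submodule.span ℝ (Set.range v))ᗮ ≠ ⊥ := by
    intro hbot
    rw [Submodule.orthogonal_eq_bot_iff] at hbot
    have := finrank_range_le_card (R := ℝ) v
    rw [Set.finrank, hbot, finrank_top] at this
    omega
  obtain ⟨x, hx, hx0⟩ := Submodule.exists_mem_ne_zero_of_ne_bot hne
  refine ⟨‖x‖⁻¹ • x, ?_, fun i => ?_⟩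
  · rw [inner_smul_left, inner_smul_right, real_inner_self_eq_norm_sq]
    have := norm_ne_zero_iff.2 hx0
    simp only [conj_trivial]
    field_simp
  · rw [inner_smul_right, (Submodule.mem_orthogonal _ _).1 hx _
      (Submodule.subset_span (Set.mem_range_self i)), mul_zero]

/-- Two alternating forms agree if they agree on increasing families of basis vectors. -/
theorem ext_of_strictMono {W : Type*} [AddCommGroup W] [Module ℝ W]
    {n k : ℕ} (b : Module.Basis (Fin n) ℝ W) {f g : W [⋀^Fin k]→ₗ[ℝ] ℝ}
    (h : ∀ v : Fin k → Fin n, StrictMono v → f (b ∘ v) = g (b ∘ v)) : f = g := by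
  refine b.ext_alternating fun v hv => ?_
  have hs : StrictMono (v ∘ Tuple.sort v) :=
    (Tuple.monotone_sort v).strictMono_of_injective (hv.comp (Tuple.sort v).injective)
  have := h _ hs
  rw [← Function.comp_assoc, f.map_perm, g.map_perm] at this
  exact smul_left_cancel _ this

end Basis
/-! ### Polarization of the norm identity -/

section Alternating

variable {V : Type*} [AddCommGroup V] [Module ℝ V]

theorem map_swap₀₁ (Φ : V [⋀^Fin 4]→ₗ[ℝ] ℝ) (x y z w : V) :
    Φ ![y, x, z, w] = -Φ ![x, y, z, w] := by
  rw [← Φ.map_swap ![x, y, z, w] (show (0 : Fin 4) ≠ 1 by decide)]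
  congr 1
  ext i; fin_cases i <;> rfl

theorem map_swap₁₂ (Φ : V [⋀^Fin 4]→ₗ[ℝ] ℝ) (x y z w : V) :
    Φ ![x, z, y, w] = -Φ ![x, y, z, w] := by
  rw [← Φ.map_swap ![x, y, z, w] (show (1 : Fin 4) ≠ 2 by decide)]
  congr 1
  ext i; fin_cases i <;> rfl

theorem map_swap₂₃ (Φ : V [⋀^Fin 4]→ₗ[ℝ] ℝ) (x y z w : V) :
    Φ ![x, y, w, z] = -Φ ![x, y, z, w] := by
  rw [← Φ.map_swap ![x, y, z, w] (show (2 : Fin 4) ≠ 3 by decide)]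
  congr 1
  ext i; fin_cases i <;> rfl

theorem cross_add_right (τ : V [⋀^Fin 3]→ₗ[ℝ] V) (u v w w' : V) :
    τ ![u, v, w + w'] = τ ![u, v, w] + τ ![u, v, w'] := by
  have := τ.map_update_add ![u, v, 0] 2 w w'
  have h (x : V) : Function.update ![u, v, 0] 2 x = ![u, v, x] := by
    ext i; fin_cases i <;> rfl
  simpa only [h] using this

theorem cross_add_middle (τ : V [⋀^Fin 3]→ₗ[ℝ] V) (u v v' w : V) :
    τ ![u, v + v', w] = τ ![u, v, w] + τ ![u, v', w] := by
  have := τ.map_update_add ![u, 0, w] 1 v v'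
  have h (x : V) : Function.update ![u, 0, w] 1 x = ![u, x, w] := by
    ext i; fin_cases i <;> rfl
  simpa only [h] using this

end Alternating

section Cross

variable {V : Type*} [NormedAddCommGroup V] [InnerProductSpace ℝ V]

variable {τ : V [⋀^Fin 3]→ₗ[ℝ] V} (hτ : ∀ u v w : V, ⟪τ ![u, v, w], τ ![u, v, w]⟫ =
    Matrix.det !![⟪u, u⟫, ⟪u, v⟫, ⟪u, w⟫; ⟪v, u⟫, ⟪v, v⟫, ⟪v, w⟫; ⟪w, u⟫, ⟪w, v⟫, ⟪w, w⟫])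
include hτ

theorem inner_cross_self {u v w : V} (hu : ⟪u, u⟫ = 1) (hv : ⟪v, v⟫ = 1) (hw : ⟪w, w⟫ = 1)
    (huv : ⟪u, v⟫ = 0) (huw : ⟪u, w⟫ = 0) (hvw : ⟪v, w⟫ = 0) :
    ⟪τ ![u, v, w], τ ![u, v, w]⟫ = 1 := by
  rw [hτ, Matrix.det_fin_three]
  simp only [Matrix.of_apply, Matrix.cons_val, hu, hv, hw, huv, huw, hvw, real_inner_comm u v,
    real_inner_comm u w, real_inner_comm v w]
  norm_num

/-- The norm identity polarized in its last argument. -/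
theorem inner_cross_cross_eq_zero {u v w w' : V} (hu : ⟪u, w⟫ = 0) (hv : ⟪v, w⟫ = 0)
    (hw : ⟪w, w'⟫ = 0) : ⟪τ ![u, v, w], τ ![u, v, w']⟫ = 0 := by
  have h := hτ u v (w + w')
  rw [cross_add_right, inner_add_add_self, hτ u v w, hτ u v w',
    real_inner_comm (τ ![u, v, w]) (τ ![u, v, w'])] at h
  simp only [Matrix.det_fin_three, Matrix.of_apply, Matrix.cons_val, inner_add_left,
    inner_add_right, hu, hv, hw, real_inner_comm u w, real_inner_comm v w,
    real_inner_comm w w'] at h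
  linarith

/-- The norm identity polarized in its last two arguments. -/
theorem inner_cross_cross_swap {u v v' w w' : V} (hu : ⟪u, w⟫ = 0) (hv : ⟪v, w⟫ = 0)
    (hv' : ⟪v', w⟫ = 0) (hw : ⟪w, w'⟫ = 0) :
    ⟪τ ![u, v, w], τ ![u, v', w']⟫ = -⟪τ ![u, v', w], τ ![u, v, w']⟫ := by
  have h := inner_cross_cross_eq_zero hτ (v := v + v') hu
    (by rw [inner_add_left, hv, hv', add_zero]) hw
  rw [cross_add_middle, cross_add_middle, inner_add_left, inner_add_right, inner_add_right,
    inner_cross_cross_eq_zero hτ hu hv hw, inner_cross_cross_eq_zero hτ hu hv' hw] at h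
  linarith

end Cross
/-! ### The normal form -/

/-- The coefficients of the Cayley-form with sign `ε` in normal form, on increasing 4-tuples of
indices; on all other 4-tuples the value is `0`. The 4-tuples with nonzero coefficient are those
whose bitwise exclusive or is zero. The coefficients with first index `0` do not
involve `ε`. -/
def cayleyCoeff (ε : ℝ) : Fin 8 → Fin 8 → Fin 8 → Fin 8 → ℝ
  | 0, 1, 2, 3 => -1
  | 0, 1, 4, 5 => -1
  | 0, 1, 6, 7 => 1
  | 0, 2, 4, 6 => -1
  | 0, 2, 5, 7 => -1
  | 0, 3, 4, 7 => -1
  | 0, 3, 5, 6 => 1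
  | 1, 2, 4, 7 => -ε
  | 1, 2, 5, 6 => ε
  | 1, 3, 4, 6 => ε
  | 1, 3, 5, 7 => ε
  | 2, 3, 4, 5 => -ε
  | 2, 3, 6, 7 => ε
  | 4, 5, 6, 7 => ε
  | _, _, _, _ => 0

/-- The increasing 4-tuples of indices on which `cayleyCoeff` is nonzero. -/
def cayleyBlocks : List (Fin 8 × Fin 8 × Fin 8 × Fin 8) :=
  [(0, 1, 2, 3), (0, 1, 4, 5), (0, 1, 6, 7), (0, 2, 4, 6), (0, 2, 5, 7), (0, 3, 4, 7),
    (0, 3, 5, 6), (1, 2, 4, 7), (1, 2, 5, 6), (1, 3, 4, 6), (1, 3, 5, 7), (2, 3, 4, 5),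
    (2, 3, 6, 7), (4, 5, 6, 7)]

theorem cayleyCoeff_of_notMem {ε : ℝ} {i j k l : Fin 8} (h : (i, j, k, l) ∉ cayleyBlocks) :
    cayleyCoeff ε i j k l = 0 := by
  unfold cayleyCoeff
  split <;> first | rfl | exact absurd (by decide) h

set_option synthInstance.maxSize 1000 in
/-- Any three distinct indices `i < j < k` lie in a block; if `i, j, k, l` is not one, the fourth
element `m` of that block is not `l`. -/
theorem exists_mem_cayleyBlocks : ∀ i j k l : Fin 8, i < j → j < k → k < l →
    (i, j, k, l) ∉ cayleyBlocks → ∃ m, m ≠ l ∧ ((m, i, j, k) ∈ cayleyBlocks ∨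
      (i, m, j, k) ∈ cayleyBlocks ∨ (i, j, m, k) ∈ cayleyBlocks ∨ (i, j, k, m) ∈ cayleyBlocks) := by
  decide +kernel

/-- The family `e` puts `Φ` in normal form with sign `ε`. Only increasing 4-tuples are mentioned,
since the other values follow by antisymmetry. -/
def IsCayleyBasis {W : Type*} [AddCommGroup W] [Module ℝ W] (Φ : W [⋀^Fin 4]→ₗ[ℝ] ℝ)
    (e : Fin 8 → W) (ε : ℝ) : Prop :=
  ∀ i j k l, i < j → j < k → k < l → Φ ![e i, e j, e k, e l] = cayleyCoeff ε i j k l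

section Orthonormal

variable {V : Type*} [NormedAddCommGroup V] [InnerProductSpace ℝ V]

theorem eq_smul_of_inner_eq {x y : V} {s : ℝ} (hx : ⟪x, x⟫ = 1) (hy : ⟪y, y⟫ = 1)
    (h : ⟪x, y⟫ = s) (hs : s ^ 2 = 1) : y = s • x := by
  rw [← sub_eq_zero, ← inner_self_eq_zero (𝕜 := ℝ)]
  simp only [inner_sub_left, inner_sub_right, inner_smul_left, inner_smul_right, hx, hy,
    real_inner_comm x y, h, conj_trivial]
  linarith

variable {Φ : V [⋀^Fin 4]→ₗ[ℝ] ℝ} {τ : V [⋀^Fin 3]→ₗ[ℝ] V}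
  (hτ : ∀ u v w : V, ⟪τ ![u, v, w], τ ![u, v, w]⟫ =
    Matrix.det !![⟪u, u⟫, ⟪u, v⟫, ⟪u, w⟫; ⟪v, u⟫, ⟪v, v⟫, ⟪v, w⟫; ⟪w, u⟫, ⟪w, v⟫, ⟪w, w⟫])
  (hΦ : ∀ x u v w : V, ⟪x, τ ![u, v, w]⟫ = Φ ![x, u, v, w])
include hτ hΦ

/-- An orthonormal family built from the triple cross product in this way puts `Φ` in normal form.
The proof writes `P i j k l` for the values of `Φ` on the family. -/
theorem exists_isCayleyBasis_of_orthonormal (hV : Module.finrank ℝ V = 8) {e : Fin 8 → V}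
    (he : Orthonormal ℝ e) (h3 : e 3 = τ ![e 0, e 1, e 2]) (h5 : e 5 = τ ![e 0, e 1, e 4])
    (h6 : e 6 = τ ![e 0, e 2, e 4]) (h7 : e 7 = τ ![e 0, e 3, e 4]) :
    ∃ ε : ℝ, (ε = 1 ∨ ε = -1) ∧ IsCayleyBasis Φ e ε := by
  have hn (i) : ⟪e i, e i⟫ = 1 := by rw [real_inner_self_eq_norm_sq, he.1 i, one_pow]
  have ho (i j) (h : i ≠ j) : ⟪e i, e j⟫ = 0 := he.2 h
  obtain ⟨P, hP⟩ : ∃ P : Fin 8 → Fin 8 → Fin 8 → Fin 8 → ℝ,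
    ∀ i j k l, Φ ![e i, e j, e k, e l] = P i j k l := ⟨_, fun _ _ _ _ => rfl⟩
  have hPτ (i j k l) : ⟪e i, τ ![e j, e k, e l]⟫ = P i j k l := by rw [hΦ, hP]
  have t₁ (i j k l) : P i j k l = -P j i k l := by simp only [← hP, map_swap₀₁ Φ (e j)]
  have t₂ (i j k l) : P i j k l = -P i k j l := by simp only [← hP, map_swap₁₂ Φ _ (e k)]
  have t₃ (i j k l) : P i j k l = -P i j l k := by simp only [← hP, map_swap₂₃ Φ _ _ (e l)]
  -- Guarded by an inequality, the swaps become rewrite rules that sort the indices.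
  have s₁ (i j k l) (_ : j < i) := t₁ i j k l
  have s₂ (i j k l) (_ : k < j) := t₂ i j k l
  have s₃ (i j k l) (_ : l < k) := t₃ i j k l
  have hnτ (i j k) (hij : i ≠ j) (hik : i ≠ k) (hjk : j ≠ k) :
      ⟪τ ![e i, e j, e k], τ ![e i, e j, e k]⟫ = 1 :=
    inner_cross_self hτ (hn i) (hn j) (hn k) (ho _ _ hij) (ho _ _ hik) (ho _ _ hjk)
  -- A coordinate `±1` of the unit vector `τ(e i, e j, e k)` leaves no room for others.
  have hcross (p i j k : Fin 8) (s : ℝ) (hij : i ≠ j) (hik : i ≠ k) (hjk : j ≠ k)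
      (hs : s ^ 2 = 1) (h : P p i j k = s) : τ ![e i, e j, e k] = s • e p :=
    eq_smul_of_inner_eq (hn p) (hnτ _ _ _ hij hik hjk) (by rw [hPτ, h]) hs
  have hzero (p i j k q : Fin 8) (s : ℝ) (hij : i ≠ j) (hik : i ≠ k) (hjk : j ≠ k) (hpq : q ≠ p)
      (hs : s ^ 2 = 1) (h : P p i j k = s) : P q i j k = 0 := by
    rw [← hPτ, hcross p i j k s hij hik hjk hs h, inner_smul_right, ho _ _ hpq, mul_zero]
  -- The polarized norm identity, read on basis vectors.
  have key (p q i j k j' k' : Fin 8) (s t : ℝ) (hp : P p i j k = s) (hq : P q i j' k = t)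
      (h : [i, j, k, j', k'].Nodup) (hs : s ^ 2 = 1) (ht : t ^ 2 = 1) :
      s * P p i j' k' = -(t * P q i j k') := by
    simp only [List.nodup_cons, List.mem_cons, List.not_mem_nil, not_or, or_false] at h
    obtain ⟨⟨hij, hik, hij', -⟩, ⟨hjk, -, -⟩, ⟨hkj', hkk'⟩, -⟩ := h
    have := inner_cross_cross_swap hτ (w' := e k') (ho _ _ hik) (ho _ _ hjk) (ho _ _ (Ne.symm hkj'))
      (ho _ _ hkk')
    rwa [hcross p i j k s hij hik hjk hs hp, hcross q i j' k t hij' hik (Ne.symm hkj') ht hq,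
      real_inner_smul_left, real_inner_smul_left, hPτ, hPτ] at this
  -- The four definitions of `e 3, e 5, e 6, e 7` say that these values are `±1`.
  have p0123 : P 0 1 2 3 = -1 := by
    have := hn 3
    nth_rw 2 [h3] at this
    rw [hPτ] at this
    simp (disch := decide) only [s₁, s₂, s₃] at this
    linarith
  have p0145 : P 0 1 4 5 = -1 := by
    have := hn 5
    nth_rw 2 [h5] at this
    rw [hPτ] at this
    simp (disch := decide) only [s₁, s₂, s₃] at this
    linarith
  have p0246 : P 0 2 4 6 = -1 := by
    have := hn 6
    nth_rw 2 [h6] at this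
    rw [hPτ] at this
    simp (disch := decide) only [s₁, s₂, s₃] at this
    linarith
  have p0347 : P 0 3 4 7 = -1 := by
    have := hn 7
    nth_rw 2 [h7] at this
    rw [hPτ] at this
    simp (disch := decide) only [s₁, s₂, s₃] at this
    linarith
  -- The other values with first index `0`.
  have p0167 : P 0 1 6 7 = 1 := by
    have := key 6 3 0 4 2 1 7 (-1) 1 (by simp (disch := decide) only [s₁, s₂, s₃, p0246]; norm_num)
      (by simp (disch := decide) only [s₁, s₂, s₃, p0123]; norm_num) (by decide) (by norm_num)
      (by norm_num)
    simp (disch := decide) only [s₁, s₂, p0347] at this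
    linarith
  have p0257 : P 0 2 5 7 = -1 := by
    have := key 5 3 0 4 1 2 7 (-1) (-1)
      (by simp (disch := decide) only [s₁, s₂, s₃, p0145]; norm_num)
      (by simp (disch := decide) only [s₁, s₂, s₃, p0123]; norm_num) (by decide) (by norm_num)
      (by norm_num)
    simp (disch := decide) only [s₁, s₂, p0347] at this
    linarith
  have p0356 : P 0 3 5 6 = 1 := by
    have := key 5 2 0 4 1 3 6 (-1) 1
      (by simp (disch := decide) only [s₁, s₂, s₃, p0145]; norm_num)
      (by simp (disch := decide) only [s₁, s₂, s₃, p0123]; norm_num) (by decide) (by norm_num)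
      (by norm_num)
    simp (disch := decide) only [s₁, s₂, p0246] at this
    linarith
  -- The values without index `0`: in each case `key` compares the value with `P 4 5 6 7`, with which
  -- it shares two indices.
  set ε := P 4 5 6 7 with hε
  have p1247 : P 1 2 4 7 = -ε := by
    have := key 5 1 7 2 0 6 4 1 1
      (by simp (disch := decide) only [s₁, s₂, s₃, p0257, neg_neg])
      (by simp (disch := decide) only [s₁, s₂, s₃, p0167, neg_neg])
      (by decide) (by norm_num) (by norm_num)
    simp (disch := decide) only [s₁, s₂, s₃] at this
    linarith
  have p1256 : P 1 2 5 6 = ε := by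
    have := key 4 2 5 1 0 7 6 1 1
      (by simp (disch := decide) only [s₁, s₂, s₃, p0145, neg_neg])
      (by simp (disch := decide) only [s₁, s₂, s₃, p0257, neg_neg])
      (by decide) (by norm_num) (by norm_num)
    simp (disch := decide) only [s₁, s₂, s₃] at this
    linarith
  have p1346 : P 1 3 4 6 = ε := by
    have := key 5 1 6 3 0 7 4 (-1) (-1)
      (by simp (disch := decide) only [s₁, s₂, s₃, p0356, neg_neg])
      (by simp (disch := decide) only [s₁, s₂, s₃, p0167, neg_neg])
      (by decide) (by norm_num) (by norm_num)
    simp (disch := decide) only [s₁, s₂, s₃] at this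
    linarith
  have p1357 : P 1 3 5 7 = ε := by
    have := key 4 1 7 3 0 6 5 1 1
      (by simp (disch := decide) only [s₁, s₂, s₃, p0347, neg_neg])
      (by simp (disch := decide) only [s₁, s₂, s₃, p0167, neg_neg])
      (by decide) (by norm_num) (by norm_num)
    simp (disch := decide) only [s₂, s₃] at this
    linarith
  have p2345 : P 2 3 4 5 = -ε := by
    have := key 6 2 5 3 0 7 4 1 1
      (by simp (disch := decide) only [s₁, s₂, s₃, p0356, neg_neg])
      (by simp (disch := decide) only [s₁, s₂, s₃, p0257, neg_neg])
      (by decide) (by norm_num) (by norm_num)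
    simp (disch := decide) only [s₁, s₂, s₃] at this
    linarith
  have p2367 : P 2 3 6 7 = ε := by
    have := key 4 3 6 2 0 5 7 1 1
      (by simp (disch := decide) only [s₁, s₂, s₃, p0246, neg_neg])
      (by simp (disch := decide) only [s₁, s₂, s₃, p0356, neg_neg])
      (by decide) (by norm_num) (by norm_num)
    simp (disch := decide) only [s₁, s₂] at this
    linarith
  -- All coordinates of the unit vector `τ(e 4, e 5, e 6)` vanish except the last, which is `-ε`.
  have hε1 : ε ^ 2 = 1 := by
    let B := (basisOfOrthonormalOfCardEqFinrank he (by simp [hV])).toOrthonormalBasis (by simpa)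
    have hB : ⇑B = e := by simp [B]
    have hsum := B.sum_sq_norm_inner_right (τ ![e 4, e 5, e 6])
    rw [← real_inner_self_eq_norm_sq, hnτ 4 5 6 (by decide) (by decide) (by decide)] at hsum
    simp only [hB, hPτ, Real.norm_eq_abs, sq_abs, Fin.sum_univ_eight] at hsum
    have z0 : P 0 4 5 6 = 0 := by
      have := hzero 1 0 4 5 6 1 (by decide) (by decide) (by decide) (by decide) (by norm_num)
        (by simp (disch := decide) only [s₁, p0145, neg_neg])
      simp (disch := decide) only [s₁, s₂, s₃] at this
      linarith
    have z1 : P 1 4 5 6 = 0 := by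
      have := hzero 0 1 4 5 6 (-1) (by decide) (by decide) (by decide) (by decide) (by norm_num) p0145
      simp (disch := decide) only [s₁, s₂, s₃] at this
      linarith
    have z2 : P 2 4 5 6 = 0 := by
      have := hzero 0 2 4 6 5 (-1) (by decide) (by decide) (by decide) (by decide) (by norm_num) p0246
      simp (disch := decide) only [s₁, s₂] at this
      linarith
    have z3 : P 3 4 5 6 = 0 := by
      have := hzero 0 3 5 6 4 1 (by decide) (by decide) (by decide) (by decide) (by norm_num) p0356
      simp (disch := decide) only [s₁] at this
      linarith
    have z4 : P 4 4 5 6 = 0 := by linarith [t₁ 4 4 5 6]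
    have z5 : P 5 4 5 6 = 0 := by linarith [t₁ 5 4 5 6, t₂ 4 5 5 6]
    have z6 : P 6 4 5 6 = 0 := by linarith [t₁ 6 4 5 6, t₂ 4 6 5 6, t₃ 4 5 6 6]
    have z7 : P 7 4 5 6 = -ε := by simp (disch := decide) only [s₁, s₂, s₃, neg_neg, hε]
    rw [z0, z1, z2, z3, z4, z5, z6, z7] at hsum
    linarith
  have hblock (i j k l) (h : (i, j, k, l) ∈ cayleyBlocks) :
      P i j k l = cayleyCoeff ε i j k l ∧ P i j k l ^ 2 = 1 := by
    simp only [cayleyBlocks, List.mem_cons, List.not_mem_nil, or_false, Prod.mk.injEq] at h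
    rcases h with h | h | h | h | h | h | h | h | h | h | h | h | h | h <;>
      obtain ⟨rfl, rfl, rfl, rfl⟩ := h
    · exact ⟨p0123, by rw [p0123]; norm_num⟩
    · exact ⟨p0145, by rw [p0145]; norm_num⟩
    · exact ⟨p0167, by rw [p0167]; norm_num⟩
    · exact ⟨p0246, by rw [p0246]; norm_num⟩
    · exact ⟨p0257, by rw [p0257]; norm_num⟩
    · exact ⟨p0347, by rw [p0347]; norm_num⟩
    · exact ⟨p0356, by rw [p0356]; norm_num⟩
    · exact ⟨p1247, by rw [p1247]; linarith⟩
    · exact ⟨p1256, by rw [p1256]; linarith⟩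
    · exact ⟨p1346, by rw [p1346]; linarith⟩
    · exact ⟨p1357, by rw [p1357]; linarith⟩
    · exact ⟨p2345, by rw [p2345]; linarith⟩
    · exact ⟨p2367, by rw [p2367]; linarith⟩
    · exact ⟨hε.symm, hε1⟩
  refine ⟨ε, by simpa using hε1, fun i j k l hij hjk hkl => ?_⟩
  rw [hP]
  by_cases h : (i, j, k, l) ∈ cayleyBlocks
  · exact (hblock i j k l h).1
  rw [cayleyCoeff_of_notMem h]
  obtain ⟨m, hm, hB⟩ := exists_mem_cayleyBlocks i j k l hij hjk hkl h
  -- `τ(e i, e j, e k)` is `± e m`, hence orthogonal to `e l`.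
  have hsq : P m i j k ^ 2 = 1 := by
    rcases hB with hB | hB | hB | hB
    · exact (hblock _ _ _ _ hB).2
    · rw [t₁, neg_sq, (hblock _ _ _ _ hB).2]
    · rw [t₁, t₂, neg_neg, (hblock _ _ _ _ hB).2]
    · rw [t₁, t₂, t₃, neg_neg, neg_sq, (hblock _ _ _ _ hB).2]
  have := hzero m i j k l _ hij.ne (hij.trans hjk).ne hjk.ne hm.symm hsq rfl
  rw [t₃, t₂, t₁, this, neg_zero, neg_zero, neg_zero]

end Orthonormal

theorem exists_isCayleyBasis {V : Type*} [NormedAddCommGroup V] [InnerProductSpace ℝ V]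
    (hV : Module.finrank ℝ V = 8) {Φ : V [⋀^Fin 4]→ₗ[ℝ] ℝ} {τ : V [⋀^Fin 3]→ₗ[ℝ] V}
    (hτ : ∀ u v w : V, ⟪τ ![u, v, w], τ ![u, v, w]⟫ =
      Matrix.det !![⟪u, u⟫, ⟪u, v⟫, ⟪u, w⟫; ⟪v, u⟫, ⟪v, v⟫, ⟪v, w⟫; ⟪w, u⟫, ⟪w, v⟫, ⟪w, w⟫])
    (hΦ : ∀ x u v w : V, ⟪x, τ ![u, v, w]⟫ = Φ ![x, u, v, w]) :
    ∃ (b : Module.Basis (Fin 8) ℝ V) (ε : ℝ), (ε = 1 ∨ ε = -1) ∧ IsCayleyBasis Φ b ε := by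
  have hrot (x u v w : V) : ⟪x, τ ![u, v, w]⟫ = -⟪w, τ ![u, v, x]⟫ := by
    rw [hΦ, hΦ, ← Φ.map_swap ![w, u, v, x] (show (0 : Fin 4) ≠ 3 by decide)]
    congr 1
    ext i; fin_cases i <;> rfl
  have hleft (u v w : V) : ⟪u, τ ![u, v, w]⟫ = 0 := by
    rw [hΦ]; exact Φ.map_eq_zero_of_eq _ (i := 0) (j := 1) rfl (by decide)
  have hmid (u v w : V) : ⟪v, τ ![u, v, w]⟫ = 0 := by
    rw [hΦ]; exact Φ.map_eq_zero_of_eq _ (i := 0) (j := 2) rfl (by decide)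
  have hright (u v w : V) : ⟪w, τ ![u, v, w]⟫ = 0 := by
    rw [hΦ]; exact Φ.map_eq_zero_of_eq _ (i := 0) (j := 3) rfl (by decide)
  have hswap (u v w : V) : τ ![u, w, v] = -τ ![u, v, w] := by
    rw [← τ.map_swap ![u, v, w] (show (1 : Fin 3) ≠ 2 by decide)]
    congr 1
    ext i; fin_cases i <;> rfl
  obtain ⟨e₀, n0, -⟩ := exists_norm_eq_one_orthogonal (V := V) ![] (by simp [hV])
  obtain ⟨e₁, n1, h1⟩ := exists_norm_eq_one_orthogonal ![e₀] (by simp [hV])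
  obtain ⟨e₂, n2, h2⟩ := exists_norm_eq_one_orthogonal ![e₀, e₁] (by simp [hV])
  have h01 : ⟪e₀, e₁⟫ = 0 := h1 0
  have h02 : ⟪e₀, e₂⟫ = 0 := h2 0
  have h12 : ⟪e₁, e₂⟫ = 0 := h2 1
  obtain ⟨e₃, h3⟩ : ∃ x, x = τ ![e₀, e₁, e₂] := ⟨_, rfl⟩
  obtain ⟨e₄, n4, h4⟩ := exists_norm_eq_one_orthogonal ![e₀, e₁, e₂, e₃] (by simp [hV])
  have h04 : ⟪e₀, e₄⟫ = 0 := h4 0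
  have h14 : ⟪e₁, e₄⟫ = 0 := h4 1
  have h24 : ⟪e₂, e₄⟫ = 0 := h4 2
  have h34 : ⟪e₃, e₄⟫ = 0 := h4 3
  obtain ⟨e₅, h5⟩ : ∃ x, x = τ ![e₀, e₁, e₄] := ⟨_, rfl⟩
  obtain ⟨e₆, h6⟩ : ∃ x, x = τ ![e₀, e₂, e₄] := ⟨_, rfl⟩
  obtain ⟨e₇, h7⟩ : ∃ x, x = τ ![e₀, e₃, e₄] := ⟨_, rfl⟩
  have h03 : ⟪e₀, e₃⟫ = 0 := h3 ▸ hleft _ _ _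
  have h13 : ⟪e₁, e₃⟫ = 0 := h3 ▸ hmid _ _ _
  have h23 : ⟪e₂, e₃⟫ = 0 := h3 ▸ hright _ _ _
  have h05 : ⟪e₀, e₅⟫ = 0 := h5 ▸ hleft _ _ _
  have h15 : ⟪e₁, e₅⟫ = 0 := h5 ▸ hmid _ _ _
  have h45 : ⟪e₄, e₅⟫ = 0 := h5 ▸ hright _ _ _
  have h06 : ⟪e₀, e₆⟫ = 0 := h6 ▸ hleft _ _ _
  have h26 : ⟪e₂, e₆⟫ = 0 := h6 ▸ hmid _ _ _
  have h46 : ⟪e₄, e₆⟫ = 0 := h6 ▸ hright _ _ _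
  have h07 : ⟪e₀, e₇⟫ = 0 := h7 ▸ hleft _ _ _
  have h37 : ⟪e₃, e₇⟫ = 0 := h7 ▸ hmid _ _ _
  have h47 : ⟪e₄, e₇⟫ = 0 := h7 ▸ hright _ _ _
  have n3 : ⟪e₃, e₃⟫ = 1 := by rw [h3]; exact inner_cross_self hτ n0 n1 n2 h01 h02 h12
  have n5 : ⟪e₅, e₅⟫ = 1 := by rw [h5]; exact inner_cross_self hτ n0 n1 n4 h01 h04 h14
  have n6 : ⟪e₆, e₆⟫ = 1 := by rw [h6]; exact inner_cross_self hτ n0 n2 n4 h02 h04 h24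
  have n7 : ⟪e₇, e₇⟫ = 1 := by rw [h7]; exact inner_cross_self hτ n0 n3 n4 h03 h04 h34
  have h25 : ⟪e₂, e₅⟫ = 0 := by rw [h5, hrot, ← h3, real_inner_comm, h34, neg_zero]
  have h16 : ⟪e₁, e₆⟫ = 0 := by
    rw [h6, hrot, hswap, ← h3, inner_neg_right, real_inner_comm, h34, neg_zero, neg_zero]
  have h35 : ⟪e₃, e₅⟫ = 0 := by
    rw [h3, h5]; exact inner_cross_cross_eq_zero hτ h02 h12 h24
  have h36 : ⟪e₃, e₆⟫ = 0 := by
    rw [h3, h6, hswap, inner_neg_left, inner_cross_cross_eq_zero hτ h01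
      (by rwa [real_inner_comm]) h14, neg_zero]
  have h17 : ⟪e₁, e₇⟫ = 0 := by
    rw [h7, hswap, inner_neg_right, hrot, hswap, ← h5, inner_neg_right, h35, neg_zero, neg_zero,
      neg_zero]
  have h27 : ⟪e₂, e₇⟫ = 0 := by
    rw [h7, hswap, inner_neg_right, hrot, hswap, ← h6, inner_neg_right, h36, neg_zero, neg_zero,
      neg_zero]
  have h56 : ⟪e₅, e₆⟫ = 0 := by
    rw [h5, h6, hswap e₀ e₄, hswap e₀ e₄, inner_neg_neg]
    exact inner_cross_cross_eq_zero hτ h01 (by rwa [real_inner_comm]) h12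
  have h57 : ⟪e₅, e₇⟫ = 0 := by
    rw [h5, h7, hswap e₀ e₄, hswap e₀ e₄, inner_neg_neg]
    exact inner_cross_cross_eq_zero hτ h01 (by rwa [real_inner_comm]) h13
  have h67 : ⟪e₆, e₇⟫ = 0 := by
    rw [h6, h7, hswap e₀ e₄, hswap e₀ e₄, inner_neg_neg]
    exact inner_cross_cross_eq_zero hτ h02 (by rwa [real_inner_comm]) h23
  have ho : ∀ i j, i < j → ⟪![e₀, e₁, e₂, e₃, e₄, e₅, e₆, e₇] i,
      ![e₀, e₁, e₂, e₃, e₄, e₅, e₆, e₇] j⟫ = 0 := by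
    intro i j hij
    fin_cases i <;> fin_cases j <;> first | assumption | exact absurd hij (by decide)
  have he : Orthonormal ℝ ![e₀, e₁, e₂, e₃, e₄, e₅, e₆, e₇] := by
    refine ⟨fun i => ?_, fun i j hij => ?_⟩
    · rw [← sq_eq_sq₀ (norm_nonneg _) zero_le_one, one_pow, ← real_inner_self_eq_norm_sq]
      fin_cases i <;> assumption
    · rcases hij.lt_or_gt with h | h
      · exact ho i j h
      · rw [real_inner_comm]; exact ho j i h
  obtain ⟨ε, hε, h⟩ := exists_isCayleyBasis_of_orthonormal hτ hΦ hV he h3 h5 h6 h7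
  refine ⟨basisOfOrthonormalOfCardEqFinrank he (by simp [hV]), ε, hε, ?_⟩
  rwa [coe_basisOfOrthonormalOfCardEqFinrank]

/-! ### Comparison of normal forms -/

section Comparison

variable {W : Type*} [AddCommGroup W] [Module ℝ W]

theorem IsCayleyForm.exists_isCayleyBasis (hW : Module.finrank ℝ W = 8)
    {Φ : W [⋀^Fin 4]→ₗ[ℝ] ℝ} (hΦ : IsCayleyForm Φ) :
    ∃ (b : Module.Basis (Fin 8) ℝ W) (ε : ℝ), (ε = 1 ∨ ε = -1) ∧ IsCayleyBasis Φ b ε := by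
  obtain ⟨c, τ, hτ, h⟩ := hΦ
  let : NormedAddCommGroup W := c.toNormedAddCommGroup
  let : InnerProductSpace ℝ W := .ofCore c.toCore
  exact CayleyForm.exists_isCayleyBasis hW hτ.norm_sq h

theorem IsCayleyBasis.compLinearMap_eq {Φ Ψ : W [⋀^Fin 4]→ₗ[ℝ] ℝ}
    {b b' : Module.Basis (Fin 8) ℝ W} {ε : ℝ} (h : IsCayleyBasis Φ b ε)
    (h' : IsCayleyBasis Ψ b' ε) :
    Φ.compLinearMap (b'.equiv b (Equiv.refl _) : W →ₗ[ℝ] W) = Ψ := by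
  refine ext_of_strictMono b' fun v hv => ?_
  have e (a : Module.Basis (Fin 8) ℝ W) : a ∘ v = ![a (v 0), a (v 1), a (v 2), a (v 3)] := by
    ext i; fin_cases i <;> rfl
  have e' : (fun i => (b'.equiv b (Equiv.refl _) : W →ₗ[ℝ] W) ((b' ∘ v) i)) = b ∘ v := by
    ext i; simp
  rw [AlternatingMap.compLinearMap_apply, e', e, e,
    h _ _ _ _ (hv (by decide)) (hv (by decide)) (hv (by decide)),
    h' _ _ _ _ (hv (by decide)) (hv (by decide)) (hv (by decide))]

theorem cayleyCoeff_neg {ε : ℝ} (i j k l : Fin 8) :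
    cayleyCoeff (-ε) i j k l =
      if i = 0 then cayleyCoeff ε i j k l else -cayleyCoeff ε i j k l := by
  by_cases h : (i, j, k, l) ∈ cayleyBlocks
  · simp only [cayleyBlocks, List.mem_cons, List.not_mem_nil, or_false, Prod.mk.injEq] at h
    rcases h with h | h | h | h | h | h | h | h | h | h | h | h | h | h <;>
      obtain ⟨rfl, rfl, rfl, rfl⟩ := h <;> simp [cayleyCoeff]
  · simp [cayleyCoeff_of_notMem h]

/-- The new basis is `-b 0, b 1, …, b 7`. -/
theorem IsCayleyBasis.neg {Φ : W [⋀^Fin 4]→ₗ[ℝ] ℝ} {b : Module.Basis (Fin 8) ℝ W} {ε : ℝ}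
    (h : IsCayleyBasis Φ b ε) :
    ∃ b' : Module.Basis (Fin 8) ℝ W, IsCayleyBasis (-Φ) b' (-ε) := by
  refine ⟨b.unitsSMul fun i => if i = 0 then -1 else 1, fun i j k l hij hjk hkl => ?_⟩
  have hj : j ≠ 0 := by omega
  have hk : k ≠ 0 := by omega
  have hl : l ≠ 0 := by omega
  simp only [Module.Basis.unitsSMul_apply, hj, hk, hl, if_false, one_smul, cayleyCoeff_neg,
    AlternatingMap.neg_apply]
  split_ifs
  · have := Φ.map_update_neg ![0, b j, b k, b l] 0 (b i)
    have e (x : W) : Function.update ![0, b j, b k, b l] 0 x = ![x, b j, b k, b l] := by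
      ext i; fin_cases i <;> rfl
    rw [e, e] at this
    rw [Units.neg_smul, one_smul, this, neg_neg, h i j k l hij hjk hkl]
  · rw [one_smul, h i j k l hij hjk hkl]

end Comparison

end CayleyForm

theorem theorem6p6 {W : Type*} [AddCommGroup W] [Module ℝ W] (hW : Module.finrank ℝ W = 8)
    (Φ Ψ : W [⋀^Fin 4]→ₗ[ℝ] ℝ) (hΦ : CayleyForm.IsPositiveCayleyForm Φ)
    (hΨ : CayleyForm.IsPositiveCayleyForm Ψ) :
    ∃ g : W ≃ₗ[ℝ] W, Φ.compLinearMap (g : W →ₗ[ℝ] W) = Ψ := by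
  obtain ⟨b, ε, hε, hb⟩ := hΦ.isCayleyForm.exists_isCayleyBasis hW
  obtain ⟨b', ε', hε', hb'⟩ := hΨ.isCayleyForm.exists_isCayleyBasis hW
  rcases eq_or_ne ε ε' with rfl | hne
  · exact ⟨_, hb.compLinearMap_eq hb'⟩
  · have hneg : ε = -ε' := by
      rcases hε with rfl | rfl <;> rcases hε' with rfl | rfl <;> simp_all
    obtain ⟨b'', hb''⟩ := hb'.neg
    rw [← hneg] at hb''
    exact absurd (hb.compLinearMap_eq hb'')
      (CayleyForm.IsPositiveCayleyForm.compLinearMap_ne_neg (by omega) hΦ hΨ _)
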